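/- Let $n\ge 2$ and let $\|\cdot\|$ be any norm on the real $n\times n$ matrices. Let $\mathcal W$ be the set of Laplacian matrices $L=D-W$ of connected, undirected, simple weighted graphs on the nodes $1,\dots,n$, where $W=(w_{i,j})$ is the symmetric matrix of weights ($w_{i,j}>0$ if $(i,j)$ is an edge, $w_{i,j}=0$ otherwise) and $D$ is the diagonal matrix with entries $D_i=\sum_j w_{i,j}$. For $L\in\mathcal W$ list the eigenvalues with multiplicity as $\lambda_1\le\lambda_2\le\dots\le\lambda_n$; a Fiedler vector of $L$ is an eigenvector of $L$ for $\lambda_2$. Let $\mathcal W_0\subset\mathcal W$ be the set of those $L$ that have a Fiedler vector with at least one zero entry. For a symmetric matrix $M$ with zero row sums and a tuple $\mathscr E=(\epsilon_{i,j})_{1\le i<j\le n}\in\mathbb R^{n(n-1)/2}$, let $\underline M(\mathscr E)$ be the symmetric matrix with zero row sums whose entry at $(i,j)$, $i<j$, is $-\epsilon_{i,j}$ if $M_{i,j}\ne0$ and $0$ otherwise. A set $\mathcal M_0\subset\mathcal W$ is structurally dense in $\mathcal W$ if for all $M\in\mathcal W$ and $\epsilon_0>0$ there is $\mathscr E\in\mathbb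 R^{n(n-1)/2}$ with $M+\underline M(\mathscr E)\in\mathcal M_0$ and $\|\underline M(\mathscr E)\|<\epsilon_0$. A property is structurally generic in $\mathcal W$ if the set of matrices in $\mathcal W$ that satisfy it is structurally dense in $\mathcal W$ and if, for each $M\in\mathcal W$, the set of $\mathscr E$ such that $\underline M(\mathscr E)$ lies in $\mathcal W$ and does not satisfy it has Lebesgue measure zero in $\mathbb R^{n(n-1)/2}$. Theorem. The property of having a Fiedler vector with only nonzero entries is structurally generic in $\mathcal W$. Moreover: - The set $\mathcal W_0^c\cap\mathcal W$ is structurally dense in $\mathcal W$. - For every $L\in\mathcal W$, the set of tuples $\mathscr E\in\mathbb R^{n(n-1)/2}$ such that $\underline L(\mathscr E)\in\mathcal W_0$ has Lebesgue measure zero. -/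

import Mathlib

open MeasureTheory
open scoped Matrix

noncomputable section

/-- An undirected weighted simple graph on `n` nodes: the edges carry positive symmetric
weights, and the weight of a pair that is not an edge is `0`. -/
structure WeightedGraph (n : ℕ) where
  graph : SimpleGraph (Fin n)
  weight : Fin n → Fin n → ℝ
  weight_symm : ∀ i j, weight i j = weight j i
  weight_pos : ∀ i j, graph.Adj i j → 0 < weight i j
  weight_zero : ∀ i j, ¬ graph.Adj i j → weight i j = 0

/-- The Laplacian `D - W`, with `W` the weighted adjacency matrix and `D` the diagonal matrix
of the weighted degrees. -/
def WeightedGraph.laplacian {n : ℕ} (G : WeightedGraph n) : Matrix (Fin n) (Fin n) ℝ :=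
  Matrix.diagonal (fun i => ∑ j, G.weight i j) - Matrix.of G.weight

/-- The set `𝒲` of Laplacian matrices of connected undirected weighted graphs on `n` nodes. -/
def connectedLaplacians (n : ℕ) : Set (Matrix (Fin n) (Fin n) ℝ) :=
  {L | ∃ G : WeightedGraph n, G.graph.Connected ∧ G.laplacian = L}

/-- `μ` is the second smallest eigenvalue of `L`, the real eigenvalues being listed in
nondecreasing order with their multiplicities (position `1` of the list counted from `0`). -/
def IsSecondEigenvalue {n : ℕ} (L : Matrix (Fin n) (Fin n) ℝ) (μ : ℝ) : Prop :=
  (L.charpoly.roots.sort (· ≤ ·))[1]? = some μ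

/-- `v` is a Fiedler vector of `L`: an eigenvector for the second smallest eigenvalue. -/
def IsFiedlerVector {n : ℕ} (L : Matrix (Fin n) (Fin n) ℝ) (v : Fin n → ℝ) : Prop :=
  v ≠ 0 ∧ ∃ μ : ℝ, IsSecondEigenvalue L μ ∧ L *ᵥ v = μ • v

/-- The set `𝒲₀` of those `L` in `𝒲` that have a Fiedler vector with at least one zero entry. -/
def connectedLaplaciansZero (n : ℕ) : Set (Matrix (Fin n) (Fin n) ℝ) :=
  {L | L ∈ connectedLaplacians n ∧ ∃ v, IsFiedlerVector L v ∧ ∃ i, v i = 0}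

/-- The property of having a Fiedler vector with only nonzero entries. -/
def HasNonzeroFiedlerVector {n : ℕ} (L : Matrix (Fin n) (Fin n) ℝ) : Prop :=
  ∃ v, IsFiedlerVector L v ∧ ∀ i, v i ≠ 0

/-- Tuples `(ε i j)` of reals indexed by the pairs `i < j`; this is `ℝ ^ (n (n - 1) / 2)`, with
the Lebesgue measure as `volume`. -/
abbrev WeightTuple (n : ℕ) : Type := {p : Fin n × Fin n // p.1 < p.2} → ℝ

/-- Off-diagonal entries of the structural perturbation: `-ε i j` at the positions `(i, j)` and
`(j, i)`, for `i < j` with `M i j ≠ 0`, and `0` elsewhere. -/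
def structuralOffDiag {n : ℕ} (M : Matrix (Fin n) (Fin n) ℝ) (ε : WeightTuple n)
    (i j : Fin n) : ℝ :=
  if h : i < j then (if M i j ≠ 0 then -ε ⟨(i, j), h⟩ else 0)
  else if h : j < i then (if M j i ≠ 0 then -ε ⟨(j, i), h⟩ else 0)
  else 0

/-- The symmetric matrix with zero row sums that has the off-diagonal entries above. -/
def structuralPerturbation {n : ℕ} (M : Matrix (Fin n) (Fin n) ℝ) (ε : WeightTuple n) :
    Matrix (Fin n) (Fin n) ℝ :=
  Matrix.of fun i j =>
    if i = j then -∑ k ∈ Finset.univ.erase i, structuralOffDiag M ε i k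
    else structuralOffDiag M ε i j

/-- `S₀` is structurally dense in `S`, sizes of matrices being measured by `N`. -/
def StructurallyDense {n : ℕ} (N : Seminorm ℝ (Matrix (Fin n) (Fin n) ℝ))
    (S₀ S : Set (Matrix (Fin n) (Fin n) ℝ)) : Prop :=
  ∀ M ∈ S, ∀ ε₀ : ℝ, 0 < ε₀ → ∃ ε : WeightTuple n,
    M + structuralPerturbation M ε ∈ S₀ ∧ N (structuralPerturbation M ε) < ε₀

/-- The property `R` is structurally generic in `S`. -/
def StructurallyGeneric {n : ℕ} (N : Seminorm ℝ (Matrix (Fin n) (Fin n) ℝ))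
    (R : Matrix (Fin n) (Fin n) ℝ → Prop) (S : Set (Matrix (Fin n) (Fin n) ℝ)) : Prop :=
  StructurallyDense N {M | M ∈ S ∧ R M} S ∧
    ∀ M ∈ S, volume {ε : WeightTuple n |
      structuralPerturbation M ε ∈ S ∧ ¬ R (structuralPerturbation M ε)} = 0

end

/-! Fix a vertex r. For symmetric M, the Krylov matrix with columns M^k e_r (k < n) is singular
exactly when some eigenvector of M vanishes at r (`det_krylov_eq_zero`, `det_krylov_ne_zero`). Its
determinant is polynomial in the perturbation tuple, so the tuples yielding a Fiedler vector with a
zero entry lie in finitely many real zero sets, one for each r. Such a set is null as soon as its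
polynomial is not identically zero.

Nonvanishing needs a single edge-supported weighting, of any sign, with no eigenvector vanishing at
r. It is built by growing a tree from r: a new leaf is attached with a suitable weight, whose
existence follows by letting the weight tend to 0 (`RootedOn.exists_insert`).

Density follows because a null set contains no nonempty open set of positive tuples. Since a Fiedler
vector exists for n ≥ 2, a Laplacian outside 𝒲₀ has one without zeros. -/

/-- A closed set is null for Haar measure as soon as every line through some fixed point meets
it in a countable set. -/
theorem addHaar_eq_zero_of_countable_lines {E : Type*} [NormedAddCommGroup E] [NormedSpace ℝ E]
    [FiniteDimensional ℝ E] [MeasurableSpace E] [BorelSpace E] (μ : Measure E)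
    [μ.IsAddHaarMeasure] {Z : Set E} (hZ : IsClosed Z) (x₀ : E)
    (h : ∀ x : E, {t : ℝ | x₀ + t • x ∈ Z}.Countable) : μ Z = 0 := by
  let P : Set (ℝ × E) := {q | x₀ + q.1 • q.2 ∈ Z}
  have hP : MeasurableSet P :=
    (hZ.preimage (f := fun q : ℝ × E => x₀ + q.1 • q.2) (by fun_prop)).measurableSet
  -- Fubini in both orders: for fixed x the t-slice is countable, hence P is null and almost every
  -- slice at fixed t is null. Such a slice with t ≠ 0 is an affine copy of Z.
  have hprod : (volume : Measure ℝ).prod μ P = 0 := by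
    rw [← Measure.prod_swap, Measure.map_apply measurable_swap hP,
      Measure.measure_prod_null (measurable_swap hP)]
    exact Filter.Eventually.of_forall fun x => (h x).measure_zero volume
  rw [Measure.measure_prod_null hP] at hprod
  have hne : (volume : Measure ℝ) {t | t ≠ 0 ∧ μ (Prod.mk t ⁻¹' P) = 0} ≠ 0 := by
    intro h0
    have h1 : ∀ᵐ t : ℝ, t ≠ 0 := by simp [ae_iff]
    have h2 : ∀ᵐ t : ℝ, ¬ (t ≠ 0 ∧ μ (Prod.mk t ⁻¹' P) = 0) := by
      rw [ae_iff]; simpa using h0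
    have h3 : ∀ᵐ t : ℝ, False := by
      filter_upwards [h1, h2, hprod] with t a b c
      exact b ⟨a, c⟩
    simp [ae_iff] at h3
  obtain ⟨t, ht, htP⟩ := nonempty_of_measure_ne_zero hne
  have hpre : Prod.mk t ⁻¹' P = (t • ·) ⁻¹' ((x₀ + ·) ⁻¹' Z) := rfl
  rw [hpre, Measure.addHaar_preimage_smul μ ht, measure_preimage_add] at htP
  rcases mul_eq_zero.1 htP with h' | h'
  · rw [ENNReal.ofReal_eq_zero] at h'
    have : 0 < |(t ^ Module.finrank ℝ E)⁻¹| := by positivity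
    linarith
  · exact h'

/-! ### Krylov determinants and eigenvectors vanishing at a vertex -/

/-- The Krylov matrix of `M` and the basis vector at `r`: its columns are `M ^ k *ᵥ e_r`. -/
def krylov {R : Type*} [CommRing R] {n : ℕ} (M : Matrix (Fin n) (Fin n) R) (r : Fin n) :
    Matrix (Fin n) (Fin n) R :=
  Matrix.of fun i k => (M ^ (k : ℕ)) i r

theorem exists_polynomial_det_krylov {n : ℕ} (A B : Matrix (Fin n) (Fin n) ℝ) (r : Fin n) :
    ∃ p : Polynomial ℝ, ∀ t, p.eval t = (krylov (A + t • B) r).det := by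
  let P : Matrix (Fin n) (Fin n) (Polynomial ℝ) :=
    A.map Polynomial.C + (Polynomial.X : Polynomial ℝ) • B.map Polynomial.C
  refine ⟨(krylov P r).det, fun t => ?_⟩
  have hP : (Polynomial.evalRingHom t).mapMatrix P = A + t • B := by
    ext i j
    simp [P, mul_comm t]
  rw [← Polynomial.coe_evalRingHom, RingHom.map_det]
  congr 1
  ext i k
  rw [← hP]
  simp only [krylov, ← map_pow]
  rfl

theorem continuous_det_krylov {n : ℕ} (r : Fin n) :
    Continuous fun M : Matrix (Fin n) (Fin n) ℝ => (krylov M r).det := by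
  refine Continuous.matrix_det (continuous_matrix fun i k => ?_)
  exact (continuous_pow (k : ℕ)).matrix_elem i r

theorem mulVec_pow_eq_smul {n : ℕ} {M : Matrix (Fin n) (Fin n) ℝ} {v : Fin n → ℝ} {c : ℝ}
    (h : M *ᵥ v = c • v) (k : ℕ) : (M ^ k) *ᵥ v = c ^ k • v := by
  induction k with
  | zero => simp
  | succ k ih => rw [pow_succ, ← Matrix.mulVec_mulVec, h, Matrix.mulVec_smul, ih, smul_smul,
      pow_succ']

/-- By symmetry v is also a left eigenvector; this pairs it with the Krylov columns. -/
theorem sum_mul_pow_apply {n : ℕ} {M : Matrix (Fin n) (Fin n) ℝ} (hM : M.IsSymm)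
    {v : Fin n → ℝ} {c : ℝ} (h : M *ᵥ v = c • v) (k : ℕ) (r : Fin n) :
    ∑ i, v i * (M ^ k) i r = c ^ k * v r := by
  have h1 := congrFun (mulVec_pow_eq_smul h k) r
  simp only [Matrix.mulVec, dotProduct, Pi.smul_apply, smul_eq_mul] at h1
  rw [← h1]
  refine Finset.sum_congr rfl fun i _ => ?_
  rw [mul_comm, ← (hM.pow k).apply]

/-- An eigenvector of a symmetric matrix that vanishes at `r` makes the Krylov matrix singular. -/
theorem det_krylov_eq_zero {n : ℕ} {M : Matrix (Fin n) (Fin n) ℝ} (hM : M.IsSymm)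
    {v : Fin n → ℝ} (hv : v ≠ 0) {c : ℝ} (h : M *ᵥ v = c • v) {r : Fin n} (hr : v r = 0) :
    (krylov M r).det = 0 := by
  refine Matrix.exists_vecMul_eq_zero_iff.1 ⟨v, hv, ?_⟩
  ext k
  simp only [Matrix.vecMul, dotProduct, krylov, Matrix.of_apply, Pi.zero_apply]
  rw [sum_mul_pow_apply hM h, hr, mul_zero]

/-- If no eigenvector of a symmetric matrix vanishes at `r`, the Krylov matrix is regular. -/
theorem det_krylov_ne_zero {n : ℕ} {M : Matrix (Fin n) (Fin n) ℝ} (hM : M.IsSymm) {r : Fin n}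
    (h : ∀ (v : Fin n → ℝ) (c : ℝ), v ≠ 0 → M *ᵥ v = c • v → v r ≠ 0) :
    (krylov M r).det ≠ 0 := by
  intro hdet
  obtain ⟨c, hc, hker⟩ := Matrix.exists_mulVec_eq_zero_iff.2 hdet
  have hH : M.IsHermitian := by
    rw [Matrix.IsHermitian, Matrix.conjTranspose_eq_transpose_of_trivial]; exact hM
  let u : Fin n → Fin n → ℝ := fun j => ⇑(hH.eigenvectorBasis j)
  let l := hH.eigenvalues
  have hu : ∀ j, M *ᵥ u j = l j • u j := hH.mulVec_eigenvectorBasis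
  have hli : LinearIndependent ℝ u :=
    hH.eigenvectorBasis.orthonormal.linearIndependent.map'
      (WithLp.linearEquiv 2 ℝ (Fin n → ℝ)).toLinearMap (LinearEquiv.ker _)
  have hu0 : ∀ j, u j ≠ 0 := fun j => hli.ne_zero j
  -- Two independent eigenvectors for one eigenvalue would have a nonzero combination vanishing at
  -- r, so the spectrum is simple.
  have hinj : Function.Injective l := by
    intro i j hij
    by_contra hne
    let v := u j r • u i - u i r • u j
    have hv : v ≠ 0 := by
      intro hv0
      have hpair : LinearIndependent ℝ ![u i, u j] := by
        have := hli.comp ![i, j] (by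
          intro a b hab
          fin_cases a <;> fin_cases b <;> simp_all [eq_comm])
        convert this using 1
        ext a
        fin_cases a <;> rfl
      have := LinearIndependent.pair_iff.1 hpair (u j r) (-u i r)
        (by simpa [v, sub_eq_add_neg] using hv0)
      exact h _ _ (hu0 j) (hu j) this.1
    refine h v (l i) hv ?_ (by simp [v, mul_comm])
    simp only [v, Matrix.mulVec_sub, Matrix.mulVec_smul, hu, ← hij, smul_sub, smul_comm (l i)]
  -- Pairing K c = 0 with each eigenvector leaves a Vandermonde system at distinct nodes.
  refine hc (Matrix.eq_zero_of_forall_index_sum_pow_mul_eq_zero hinj fun j => ?_)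
  have h1 : ∑ i, u j i * (krylov M r *ᵥ c) i = 0 := by simp [hker]
  have h2 : u j r * ∑ k : Fin n, l j ^ (k : ℕ) * c k = 0 := by
    rw [← h1]
    simp only [Matrix.mulVec, dotProduct, krylov, Matrix.of_apply, Finset.mul_sum]
    rw [Finset.sum_comm]
    refine Finset.sum_congr rfl fun k _ => ?_
    have := sum_mul_pow_apply hM (hu j) k r
    rw [← mul_assoc, mul_comm (u j r), ← this, Finset.sum_mul]
    exact Finset.sum_congr rfl fun i _ => by ring
  exact (mul_eq_zero.1 h2).resolve_left (h _ _ (hu0 j) (hu j))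

/-! ### Weights without eigenvectors vanishing at the root -/

/-- The action of the weighted graph Laplacian with weights `w`. -/
def lapAct {n : ℕ} (w : Fin n → Fin n → ℝ) (v : Fin n → ℝ) (i : Fin n) : ℝ :=
  ∑ j, w i j * (v i - v j)

/-- Being an eigenvector or zero, expressed without the eigenvalue. -/
def LapCollinear {n : ℕ} (w : Fin n → Fin n → ℝ) (v : Fin n → ℝ) : Prop :=
  ∀ i j, lapAct w v i * v j = lapAct w v j * v i

theorem LapCollinear.exists_eigenvalue {n : ℕ} {w : Fin n → Fin n → ℝ} {v : Fin n → ℝ}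
    (h : LapCollinear w v) (hv : v ≠ 0) : ∃ c, ∀ i, lapAct w v i = c * v i := by
  obtain ⟨j, hj⟩ := Function.ne_iff.1 hv
  refine ⟨lapAct w v j / v j, fun i => ?_⟩
  have hj' : v j ≠ 0 := hj
  field_simp
  linarith [h i j]

theorem sum_lapAct {n : ℕ} {w : Fin n → Fin n → ℝ} (hw : ∀ i j, w i j = w j i) (v : Fin n → ℝ) :
    ∑ i, lapAct w v i = 0 := by
  have h : ∑ i, lapAct w v i = -∑ i, lapAct w v i := by
    conv_rhs => simp only [lapAct]; rw [Finset.sum_comm]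
    simp only [lapAct, ← Finset.sum_neg_distrib]
    refine Finset.sum_congr rfl fun i _ => Finset.sum_congr rfl fun j _ => ?_
    rw [hw j i]; ring
  linarith

/-- The indicator of the edge `{p, u}` as a weight matrix. -/
def edgeWeight {n : ℕ} (p u : Fin n) (i j : Fin n) : ℝ :=
  if (i = p ∧ j = u) ∨ (i = u ∧ j = p) then 1 else 0

theorem lapAct_add_edgeWeight {n : ℕ} (w : Fin n → Fin n → ℝ) {p u : Fin n} (hpu : p ≠ u) (t : ℝ)
    (v : Fin n → ℝ) (i : Fin n) :
    lapAct (fun i j => w i j + t * edgeWeight p u i j) v i = lapAct w v i +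
      t * ((if i = p then v p - v u else 0) + (if i = u then v u - v p else 0)) := by
  have h : ∀ j, (w i j + t * edgeWeight p u i j) * (v i - v j) = w i j * (v i - v j) +
      t * ((if j = u then (if i = p then v p - v u else 0) else 0)
        + (if j = p then (if i = u then v u - v p else 0) else 0)) := by
    intro j
    unfold edgeWeight
    split_ifs <;> grind
  simp only [lapAct, h, Finset.sum_add_distrib, ← Finset.mul_sum]
  simp

/-- The eigenvectors of the Laplacian with weights `w` that are supported on `S` do not vanish
at `r`. -/
def RootedOn {n : ℕ} (S : Finset (Fin n)) (r : Fin n) (w : Fin n → Fin n → ℝ) : Prop :=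
  ∀ v : Fin n → ℝ, v ≠ 0 → (∀ i ∉ S, v i = 0) → LapCollinear w v → v r ≠ 0

/-- Since u is isolated for w, resetting v at u to 0 does not change the action; the truncated
vector lies in the kernel and is supported on S, so rootedness kills it. -/
theorem RootedOn.eq_zero_of_lapAct_eq_zero {n : ℕ} {S : Finset (Fin n)} {r u : Fin n}
    {w : Fin n → Fin n → ℝ} (h : RootedOn S r w) (hS : ∀ i j, i ∉ S ∨ j ∉ S → w i j = 0)
    (hu : u ∉ S) {v : Fin n → ℝ} (hv : ∀ i ∉ insert u S, v i = 0)
    (hvr : v r = 0) (hL : ∀ i, lapAct w v i = 0) : ∀ i ≠ u, v i = 0 := by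
  let v' : Fin n → ℝ := fun i => if i = u then 0 else v i
  have hact : ∀ i, lapAct w v' i = lapAct w v i := by
    intro i
    refine Finset.sum_congr rfl fun j _ => ?_
    by_cases hi : i = u
    · rw [hS i j (Or.inl (hi ▸ hu))]; ring
    · by_cases hj : j = u
      · rw [hS i j (Or.inr (hj ▸ hu))]; ring
      · simp [v', hi, hj]
  have hv' : v' = 0 := by
    by_contra hne
    refine h v' hne ?_ ?_ ?_
    · intro i hi
      by_cases hiu : i = u
      · simp [v', hiu]
      · simp [v', hiu, hv i (by simp [hiu, hi])]
    · intro i j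
      simp [hact, hL]
    · simp [v', hvr]
  intro i hi
  simpa [v', hi] using congrFun hv' i

/-- If every t failed, unit eigenvectors vanishing at r would accumulate, as t → 0, at one for w.
Rootedness on S leaves only multiples of e_u, and the zero-sum condition, which survives the limit,
excludes these. -/
theorem RootedOn.exists_insert {n : ℕ} {S : Finset (Fin n)} {r p u : Fin n}
    {w : Fin n → Fin n → ℝ} (h : RootedOn S r w) (hw : ∀ i j, w i j = w j i)
    (hS : ∀ i j, i ∉ S ∨ j ∉ S → w i j = 0)
    (hp : p ∈ S) (hu : u ∉ S) :
    ∃ t : ℝ, RootedOn (insert u S) r fun i j => w i j + t * edgeWeight p u i j := by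
  have hpu : p ≠ u := fun e => hu (e ▸ hp)
  by_contra! hcon
  let wt : ℝ → Fin n → Fin n → ℝ := fun t i j => w i j + t * edgeWeight p u i j
  have hwt : ∀ t i j, wt t i j = wt t j i := by
    intro t i j
    simp only [wt, hw i j, edgeWeight]
    congr 2
    grind
  have hact : ∀ t v i, lapAct (wt t) v i = lapAct w v i +
      t * ((if i = p then v p - v u else 0) + (if i = u then v u - v p else 0)) :=
    fun t v i => lapAct_add_edgeWeight w hpu t v i
  have hactu : ∀ v, lapAct w v u = 0 := fun v =>
    Finset.sum_eq_zero fun j _ => by rw [hS u j (Or.inl hu), zero_mul]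
  -- Collinearity is a closed condition on (t, v), so no bound on the eigenvalues is needed.
  let C : Set (ℝ × (Fin n → ℝ)) := {q | (∀ i ∉ insert u S, q.2 i = 0) ∧ q.2 r = 0 ∧
    ∑ i, q.2 i = 0 ∧ LapCollinear (wt q.1) q.2}
  let K := (Set.Icc (0 : ℝ) 1 ×ˢ Metric.sphere (0 : Fin n → ℝ) 1) ∩ C
  have hC : IsClosed C := by
    have hc : ∀ i, Continuous fun q : ℝ × (Fin n → ℝ) => lapAct (wt q.1) q.2 i := by
      intro i
      simp only [lapAct, wt]
      fun_prop
    simp only [C, LapCollinear, Set.ofPred_and, Set.ofPred_forall]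
    refine IsClosed.inter ?_ (IsClosed.inter ?_ (IsClosed.inter ?_ ?_))
    · exact isClosed_iInter fun i => isClosed_iInter fun _ => isClosed_eq (by fun_prop) (by fun_prop)
    · exact isClosed_eq (by fun_prop) (by fun_prop)
    · exact isClosed_eq (by fun_prop) (by fun_prop)
    · exact isClosed_iInter fun i => isClosed_iInter fun j => isClosed_eq
        ((hc i).mul (by fun_prop)) ((hc j).mul (by fun_prop))
  have hK : IsClosed (Prod.fst '' K) :=
    (((isCompact_Icc.prod (isCompact_sphere _ _)).inter_right hC).image continuous_fst).isClosed
  have hmem : Set.Ioc (0 : ℝ) 1 ⊆ Prod.fst '' K := by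
    intro t ht
    have h1 := hcon t
    simp only [RootedOn, not_forall, not_not] at h1
    obtain ⟨v, hv0, hvS, hcol, hvr⟩ := h1
    have hcol : LapCollinear (wt t) v := hcol
    have hsum : ∑ i, v i = 0 := by
      obtain ⟨c, hc⟩ := hcol.exists_eigenvalue hv0
      have h2 : c * ∑ i, v i = 0 := by
        rw [Finset.mul_sum, ← sum_lapAct (hwt t) v]
        exact Finset.sum_congr rfl fun i _ => (hc i).symm
      -- For eigenvalue 0 and t ≠ 0, the equation at the leaf forces v u = v p; v is then in the
      -- kernel for w, hence zero off u, and v u = v p = 0.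
      refine (mul_eq_zero.1 h2).resolve_left fun hc0 => hv0 ?_
      have hvu : v u = v p := by
        have h3 := hc u
        rw [hact, hactu, hc0] at h3
        simp only [hpu.symm, if_true, if_false, zero_add, zero_mul] at h3
        linarith [(mul_eq_zero.1 h3).resolve_left ht.1.ne']
      have hz := h.eq_zero_of_lapAct_eq_zero hS hu hvS hvr fun i => by
        have h3 := hc i
        rw [hact, hc0, hvu] at h3
        simpa using h3
      ext i
      by_cases hi : i = u
      · rw [hi, hvu]; exact hz p hpu
      · exact hz i hi
    have hn : ‖v‖ ≠ 0 := norm_ne_zero_iff.2 hv0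
    have hlin : ∀ i, lapAct (wt t) (‖v‖⁻¹ • v) i = ‖v‖⁻¹ * lapAct (wt t) v i := by
      intro i
      simp only [lapAct, Finset.mul_sum, Pi.smul_apply, smul_eq_mul]
      exact Finset.sum_congr rfl fun j _ => by ring
    refine ⟨(t, ‖v‖⁻¹ • v), ⟨⟨⟨ht.1.le, ht.2⟩, ?_⟩, ?_, ?_, ?_, ?_⟩, rfl⟩
    · simp [norm_smul, hn]
    · intro i hi
      simp [hvS i hi]
    · simp [hvr]
    · simp [← Finset.mul_sum, hsum]
    · intro i j
      simp only [hlin, Pi.smul_apply, smul_eq_mul]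
      linear_combination (‖v‖⁻¹ * ‖v‖⁻¹) * hcol i j
  have h0 : (0 : ℝ) ∈ Prod.fst '' K := by
    have : (0 : ℝ) ∈ closure (Set.Ioc (0 : ℝ) 1) := by
      rw [closure_Ioc zero_ne_one]; simp
    exact hK.closure_subset_iff.2 hmem this
  obtain ⟨⟨t, v⟩, ⟨⟨_, hsph⟩, hvS, hvr, hsum, hcol⟩, rfl⟩ := h0
  have hv0 : v ≠ 0 := by
    rintro rfl
    simp at hsph
  have hw0 : wt 0 = w := by ext i j; simp [wt]
  dsimp only at hvS hvr hsum hcol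
  rw [hw0] at hcol
  obtain ⟨c, hc⟩ := hcol.exists_eigenvalue hv0
  by_cases hc0 : c = 0
  · have hz := h.eq_zero_of_lapAct_eq_zero hS hu hvS hvr fun i => by simp [hc, hc0]
    refine hv0 (funext fun i => ?_)
    by_cases hi : i = u
    · rw [Finset.sum_eq_single u (fun j _ hj => hz j hj) (by simp)] at hsum
      rw [hi]; exact hsum
    · exact hz i hi
  · refine h v hv0 (fun i hi => ?_) hcol hvr
    by_cases hiu : i = u
    · have := hc u
      rw [hactu] at this
      rw [hiu]
      exact (mul_eq_zero.1 this.symm).resolve_left hc0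
    · exact hvS i (by simp [hiu, hi])

/-- Every connected graph carries weights for which no Laplacian eigenvector vanishes at a
prescribed vertex. -/
theorem SimpleGraph.Connected.exists_weight_eigenvector_ne_zero {n : ℕ} {G : SimpleGraph (Fin n)}
    (hG : G.Connected) (r : Fin n) :
    ∃ w : Fin n → Fin n → ℝ, (∀ i j, w i j = w j i) ∧ (∀ i j, ¬ G.Adj i j → w i j = 0) ∧
      ∀ v : Fin n → ℝ, v ≠ 0 → LapCollinear w v → v r ≠ 0 := by
  have key : ∀ k, k + 1 ≤ n → ∃ S : Finset (Fin n), S.card = k + 1 ∧ r ∈ S ∧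
      ∃ w : Fin n → Fin n → ℝ, (∀ i j, w i j = w j i) ∧ (∀ i j, ¬ G.Adj i j → w i j = 0) ∧
        (∀ i j, i ∉ S ∨ j ∉ S → w i j = 0) ∧ RootedOn S r w := by
    intro k
    induction k with
    | zero =>
      refine fun _ => ⟨{r}, by simp, by simp, 0, by simp, by simp, by simp, ?_⟩
      intro v hv hS _ hr
      refine hv (funext fun i => ?_)
      by_cases hi : i = r
      · rw [hi]; exact hr
      · exact hS i (by simpa using hi)
    | succ k ih =>
      intro hk
      obtain ⟨S, hcard, hr, w, hw, hadj, hS, hroot⟩ := ih (by omega)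
      obtain ⟨x, hx⟩ : ∃ x, x ∉ S := by
        by_contra! hall
        have : S = Finset.univ := Finset.eq_univ_iff_forall.2 hall
        rw [this, Finset.card_fin] at hcard
        omega
      obtain ⟨q⟩ := hG.preconnected r x
      -- A walk from r to a vertex outside S crosses an edge leaving S, which carries the next leaf.
      obtain ⟨d, -, hp, hu⟩ := q.exists_boundary_dart (S : Set (Fin n)) hr hx
      have hp : d.fst ∈ S := hp
      have hu : d.snd ∉ S := hu
      obtain ⟨t, ht⟩ := hroot.exists_insert hw hS hp hu
      refine ⟨insert d.snd S, by rw [Finset.card_insert_of_notMem hu, hcard],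
        Finset.mem_insert_of_mem hr, _, ?_, ?_, ?_, ht⟩
      · intro i j
        rw [hw i j, edgeWeight, edgeWeight]
        congr 2
        grind
      · intro i j hij
        have : edgeWeight d.fst d.snd i j = 0 := by
          refine if_neg ?_
          rintro (⟨rfl, rfl⟩ | ⟨rfl, rfl⟩)
          · exact hij d.adj
          · exact hij d.adj.symm
        rw [hadj i j hij, this]; ring
      · intro i j hij
        have : edgeWeight d.fst d.snd i j = 0 := by
          refine if_neg ?_
          grind
        rw [hS i j (by grind), this]; ring
  have hn : 0 < n := r.pos
  obtain ⟨S, hcard, -, w, hw, hadj, -, hroot⟩ := key (n - 1) (by omega)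
  have hSu : S = Finset.univ := by
    rw [← Finset.card_eq_iff_eq_univ, hcard, Fintype.card_fin]; omega
  exact ⟨w, hw, hadj, fun v hv hcol => hroot v hv (by simp [hSu]) hcol⟩

/-! ### Structural perturbations as a linear family -/

theorem structuralOffDiag_add {n : ℕ} (M : Matrix (Fin n) (Fin n) ℝ) (ε δ : WeightTuple n)
    (i j : Fin n) :
    structuralOffDiag M (ε + δ) i j = structuralOffDiag M ε i j + structuralOffDiag M δ i j := by
  unfold structuralOffDiag
  split_ifs <;> simp [add_comm]

theorem structuralOffDiag_smul {n : ℕ} (M : Matrix (Fin n) (Fin n) ℝ) (c : ℝ) (ε : WeightTuple n)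
    (i j : Fin n) :
    structuralOffDiag M (c • ε) i j = c * structuralOffDiag M ε i j := by
  unfold structuralOffDiag
  split_ifs <;> simp

/-- The structural perturbation as a linear map of the tuple. -/
noncomputable def structuralPerturbationLinear {n : ℕ} (M : Matrix (Fin n) (Fin n) ℝ) :
    WeightTuple n →ₗ[ℝ] Matrix (Fin n) (Fin n) ℝ where
  toFun := structuralPerturbation M
  map_add' ε δ := by
    ext i j
    simp only [structuralPerturbation, structuralOffDiag_add, Matrix.of_apply, Matrix.add_apply,
      Finset.sum_add_distrib]
    split_ifs <;> ring
  map_smul' c ε := by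
    ext i j
    simp only [structuralPerturbation, structuralOffDiag_smul, Matrix.of_apply, Matrix.smul_apply,
      ← Finset.mul_sum, RingHom.id_apply, smul_eq_mul]
    split_ifs <;> ring

theorem structuralPerturbation_add {n : ℕ} (M : Matrix (Fin n) (Fin n) ℝ) (ε δ : WeightTuple n) :
    structuralPerturbation M (ε + δ) = structuralPerturbation M ε + structuralPerturbation M δ :=
  (structuralPerturbationLinear M).map_add ε δ

theorem structuralPerturbation_smul {n : ℕ} (M : Matrix (Fin n) (Fin n) ℝ) (c : ℝ)
    (ε : WeightTuple n) :
    structuralPerturbation M (c • ε) = c • structuralPerturbation M ε :=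
  (structuralPerturbationLinear M).map_smul c ε

theorem continuous_structuralPerturbation {n : ℕ} (M : Matrix (Fin n) (Fin n) ℝ) :
    Continuous (structuralPerturbation M) :=
  (structuralPerturbationLinear M).continuous_of_finiteDimensional

theorem structuralOffDiag_comm {n : ℕ} (M : Matrix (Fin n) (Fin n) ℝ) (ε : WeightTuple n)
    (i j : Fin n) : structuralOffDiag M ε i j = structuralOffDiag M ε j i := by
  unfold structuralOffDiag
  split_ifs <;> first | rfl | (exfalso; omega)

theorem isSymm_structuralPerturbation {n : ℕ} (M : Matrix (Fin n) (Fin n) ℝ)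
    (ε : WeightTuple n) : (structuralPerturbation M ε).IsSymm := by
  ext i j
  by_cases h : i = j
  · simp [h]
  · simp [structuralPerturbation, h, Ne.symm h, structuralOffDiag_comm M ε i j]

theorem structuralPerturbation_mulVec {n : ℕ} (M : Matrix (Fin n) (Fin n) ℝ) (ε : WeightTuple n)
    (v : Fin n → ℝ) (i : Fin n) :
    (structuralPerturbation M ε *ᵥ v) i = lapAct (fun i j => -structuralOffDiag M ε i j) v i := by
  simp only [Matrix.mulVec, dotProduct, lapAct, structuralPerturbation, Matrix.of_apply]
  rw [← Finset.add_sum_erase _ _ (Finset.mem_univ i),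
    ← Finset.add_sum_erase (Finset.univ) (fun j => -structuralOffDiag M ε i j * (v i - v j))
      (Finset.mem_univ i)]
  simp only [if_true, sub_self, mul_zero, zero_add, ← Finset.sum_neg_distrib, Finset.sum_mul,
    ← Finset.sum_add_distrib]
  refine Finset.sum_congr rfl fun j hj => ?_
  rw [if_neg (Finset.ne_of_mem_erase hj).symm]
  ring

namespace WeightedGraph

variable {n : ℕ} (G : WeightedGraph n)

theorem laplacian_apply_ne {i j : Fin n} (h : i ≠ j) : G.laplacian i j = -G.weight i j := by
  simp [laplacian, h]

theorem weight_self (i : Fin n) : G.weight i i = 0 := G.weight_zero i i (G.graph.loopless.irrefl i)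

theorem laplacian_ne_zero_iff {i j : Fin n} (h : i ≠ j) :
    G.laplacian i j ≠ 0 ↔ G.graph.Adj i j := by
  rw [G.laplacian_apply_ne h, neg_ne_zero]
  exact ⟨fun h' => by_contra fun h'' => h' (G.weight_zero i j h''),
    fun h' => (G.weight_pos i j h').ne'⟩

/-- A symmetric function supported on the edges is recovered from its values at pairs `i < j`. -/
theorem structuralOffDiag_laplacian {w : Fin n → Fin n → ℝ} (hw : ∀ i j, w i j = w j i)
    (h0 : ∀ i j, ¬ G.graph.Adj i j → w i j = 0) {ε : WeightTuple n}
    (hε : ∀ p, G.graph.Adj p.1.1 p.1.2 → ε p = w p.1.1 p.1.2) (i j : Fin n) :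
    structuralOffDiag G.laplacian ε i j = -w i j := by
  by_cases hadj : G.graph.Adj i j
  · unfold structuralOffDiag
    rcases lt_trichotomy i j with h | h | h
    · rw [dif_pos h, if_pos ((G.laplacian_ne_zero_iff h.ne).2 hadj), hε ⟨(i, j), h⟩ hadj]
    · exact (hadj.ne h).elim
    · rw [dif_neg h.not_gt, dif_pos h, if_pos ((G.laplacian_ne_zero_iff h.ne).2 hadj.symm),
        hε ⟨(j, i), h⟩ hadj.symm, hw]
  · rw [h0 i j hadj]
    unfold structuralOffDiag
    split_ifs with h1 h2 h3 h4
    · exact (hadj ((G.laplacian_ne_zero_iff h1.ne).1 h2)).elim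
    · simp
    · exact (hadj ((G.laplacian_ne_zero_iff h3.ne).1 h4).symm).elim
    · simp
    · simp

/-- The weights of `G` as a tuple, with the value `1` at the pairs that are not edges. -/
noncomputable def weightTuple : WeightTuple n :=
  -- Non-edge entries do not affect the perturbation; the value 1 puts the tuple in the open
  -- positive orthant.
  open Classical in fun p => if G.graph.Adj p.1.1 p.1.2 then G.weight p.1.1 p.1.2 else 1

theorem weightTuple_pos (p) : 0 < G.weightTuple p := by
  unfold weightTuple
  split_ifs with h
  · exact G.weight_pos _ _ h
  · exact one_pos

theorem structuralPerturbation_eq_laplacian (H : WeightedGraph n) (hGH : H.graph ≤ G.graph)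
    {ε : WeightTuple n} (hε : ∀ p, G.graph.Adj p.1.1 p.1.2 → ε p = H.weight p.1.1 p.1.2) :
    structuralPerturbation G.laplacian ε = H.laplacian := by
  have h := G.structuralOffDiag_laplacian H.weight_symm
    (fun i j hij => H.weight_zero i j fun h => hij (hGH h)) hε
  ext i j
  by_cases hij : i = j
  · subst hij
    rw [structuralPerturbation, Matrix.of_apply, if_pos rfl]
    simp only [h]
    simp only [laplacian, Matrix.of_apply, Matrix.sub_apply,
      Matrix.diagonal_apply_eq, Finset.sum_neg_distrib, neg_neg]
    rw [← Finset.add_sum_erase _ _ (Finset.mem_univ i), H.weight_self]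
    ring
  · simp [structuralPerturbation, hij, h, H.laplacian_apply_ne hij]

theorem structuralPerturbation_weightTuple :
    structuralPerturbation G.laplacian G.weightTuple = G.laplacian :=
  G.structuralPerturbation_eq_laplacian G le_rfl fun p hp => by simp [weightTuple, hp]

/-- The graph of `G` with weights read off a positive tuple. -/
noncomputable def reweight (ε : WeightTuple n) (hε : ∀ p, 0 < ε p) : WeightedGraph n where
  graph := G.graph
  weight i j := -structuralOffDiag G.laplacian ε i j
  weight_symm i j := by rw [structuralOffDiag_comm]
  weight_pos i j hij := by
    unfold structuralOffDiag
    rcases lt_trichotomy i j with h | h | h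
    · rw [dif_pos h, if_pos ((G.laplacian_ne_zero_iff h.ne).2 hij), neg_neg]
      exact hε _
    · exact (hij.ne h).elim
    · rw [dif_neg h.not_gt, dif_pos h, if_pos ((G.laplacian_ne_zero_iff h.ne).2 hij.symm), neg_neg]
      exact hε _
  weight_zero i j hij := by
    unfold structuralOffDiag
    split_ifs with h1 h2 h3 h4
    · exact (hij ((G.laplacian_ne_zero_iff h1.ne).1 h2)).elim
    · simp
    · exact (hij ((G.laplacian_ne_zero_iff h3.ne).1 h4).symm).elim
    · simp
    · simp

theorem structuralPerturbation_eq_reweight (ε : WeightTuple n) (hε : ∀ p, 0 < ε p) :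
    structuralPerturbation G.laplacian ε = (G.reweight ε hε).laplacian := by
  refine G.structuralPerturbation_eq_laplacian (G.reweight ε hε) le_rfl fun p hp => ?_
  simp [reweight, structuralOffDiag, p.2, (G.laplacian_ne_zero_iff p.2.ne).2 hp]

theorem isSymm_laplacian : G.laplacian.IsSymm := by
  rw [← G.structuralPerturbation_weightTuple]
  exact isSymm_structuralPerturbation _ _

/-- For almost all tuples, no eigenvector of the perturbation vanishes at `r`. -/
theorem volume_det_krylov_eq_zero (hG : G.graph.Connected) (r : Fin n) :
    volume {ε : WeightTuple n |
      (krylov (structuralPerturbation G.laplacian ε) r).det = 0} = 0 := by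
  obtain ⟨w, hw, h0, hroot⟩ := hG.exists_weight_eigenvector_ne_zero r
  let ε₀ : WeightTuple n := fun p => w p.1.1 p.1.2
  have hne : (krylov (structuralPerturbation G.laplacian ε₀) r).det ≠ 0 := by
    refine det_krylov_ne_zero (isSymm_structuralPerturbation _ _) fun v c hv hvc => hroot v hv ?_
    have hact : ∀ i, lapAct w v i = c * v i := by
      intro i
      have h1 := congrFun hvc i
      rw [structuralPerturbation_mulVec] at h1
      have h2 : (fun i j => -structuralOffDiag G.laplacian ε₀ i j) = w := by
        ext i j
        rw [G.structuralOffDiag_laplacian hw h0 (fun _ _ => rfl), neg_neg]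
      rwa [h2] at h1
    intro i j
    rw [hact, hact]; ring
  -- On any line through ε₀ the determinant is a one-variable polynomial, nonzero at t = 0, so it
  -- has finitely many roots.
  refine addHaar_eq_zero_of_countable_lines volume
    (isClosed_eq ((continuous_det_krylov r).comp (continuous_structuralPerturbation _))
      continuous_const) ε₀ fun x => Set.Finite.countable ?_
  obtain ⟨p, hp⟩ := exists_polynomial_det_krylov (structuralPerturbation G.laplacian ε₀)
    (structuralPerturbation G.laplacian x) r
  have hp0 : p ≠ 0 := by
    rintro rfl
    have := hp 0
    simp [Ne.symm hne] at this
  refine (p.finite_setOfPred_isRoot hp0).subset fun t ht => ?_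
  have ht : (krylov (structuralPerturbation G.laplacian (ε₀ + t • x)) r).det = 0 := ht
  rw [structuralPerturbation_add, structuralPerturbation_smul, ← hp] at ht
  exact ht

end WeightedGraph

/-! ### Null sets, density and Fiedler vectors -/

theorem isSymm_of_mem_connectedLaplacians {n : ℕ} {L : Matrix (Fin n) (Fin n) ℝ}
    (hL : L ∈ connectedLaplacians n) : L.IsSymm := by
  obtain ⟨G, -, rfl⟩ := hL
  exact G.isSymm_laplacian

theorem volume_structuralPerturbation_mem_connectedLaplaciansZero {n : ℕ}
    {L : Matrix (Fin n) (Fin n) ℝ} (hL : L ∈ connectedLaplacians n) :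
    volume {ε : WeightTuple n | structuralPerturbation L ε ∈ connectedLaplaciansZero n} = 0 := by
  obtain ⟨G, hG, rfl⟩ := hL
  refine measure_mono_null ?_ (measure_iUnion_null fun r => G.volume_det_krylov_eq_zero hG r)
  rintro ε ⟨-, v, ⟨hv, μ, -, hμ⟩, r, hr⟩
  exact Set.mem_iUnion.2 ⟨r, det_krylov_eq_zero (isSymm_structuralPerturbation _ _) hv hμ hr⟩

/-- Symmetry makes the characteristic polynomial split over ℝ, so the root list has length n ≥ 2 and
position 1 is occupied. -/
theorem exists_isFiedlerVector {n : ℕ} (hn : 2 ≤ n) {L : Matrix (Fin n) (Fin n) ℝ}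
    (hL : L.IsSymm) : ∃ v, IsFiedlerVector L v := by
  have hH : L.IsHermitian := by
    rw [Matrix.IsHermitian, Matrix.conjTranspose_eq_transpose_of_trivial]; exact hL
  have hlen : 1 < (L.charpoly.roots.sort (· ≤ ·)).length := by
    rw [Multiset.length_sort, hH.roots_charpoly_eq_eigenvalues]
    simp only [Multiset.card_map, Finset.card_val, Finset.card_univ, Fintype.card_fin]
    omega
  have hmem : (L.charpoly.roots.sort (· ≤ ·))[1] ∈ L.charpoly.roots :=
    (Multiset.mem_sort (r := (· ≤ ·))).1 (List.getElem_mem hlen)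
  have hroot := Polynomial.isRoot_of_mem_roots hmem
  rw [Polynomial.IsRoot, Matrix.eval_charpoly] at hroot
  obtain ⟨v, hv, hker⟩ := Matrix.exists_mulVec_eq_zero_iff.2 hroot
  refine ⟨v, hv, _, List.getElem?_eq_getElem hlen, ?_⟩
  rw [Matrix.sub_mulVec, sub_eq_zero] at hker
  rw [← hker]
  ext i
  simp [Matrix.scalar_apply, Matrix.mulVec_diagonal]

theorem hasNonzeroFiedlerVector_of_notMem {n : ℕ} (hn : 2 ≤ n) {L : Matrix (Fin n) (Fin n) ℝ}
    (hL : L ∈ connectedLaplacians n) (h0 : L ∉ connectedLaplaciansZero n) :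
    HasNonzeroFiedlerVector L := by
  obtain ⟨v, hv⟩ := exists_isFiedlerVector hn (isSymm_of_mem_connectedLaplacians hL)
  exact ⟨v, hv, fun i hi => h0 ⟨hL, v, hv, i, hi⟩⟩

theorem structurallyDense_compl_connectedLaplaciansZero {n : ℕ}
    (N : Seminorm ℝ (Matrix (Fin n) (Fin n) ℝ)) :
    StructurallyDense N ((connectedLaplaciansZero n)ᶜ ∩ connectedLaplacians n)
      (connectedLaplacians n) := by
  intro M hM ε₀ hε₀
  obtain ⟨G, hG, rfl⟩ := id hM
  have hNc : Continuous fun ε : WeightTuple n => N (structuralPerturbation G.laplacian ε) := by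
    let N' : Seminorm ℝ (WeightTuple n) := N.comp (structuralPerturbationLinear G.laplacian)
    exact N'.convexOn.locallyLipschitz.continuous
  -- Positivity keeps the perturbed matrix in 𝒲 on the same graph; subtracting the weights of G
  -- turns absolute weights into increments.
  let U : Set (WeightTuple n) := {ε | (∀ p, 0 < ε p) ∧
    N (structuralPerturbation G.laplacian (ε - G.weightTuple)) < ε₀}
  have hU : IsOpen U := by
    simp only [U, Set.ofPred_and, Set.ofPred_forall]
    refine IsOpen.inter (isOpen_iInter_of_finite fun p =>
      isOpen_lt continuous_const (continuous_apply p)) ?_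
    exact isOpen_lt (hNc.comp (continuous_id.sub continuous_const)) continuous_const
  have hUne : U.Nonempty := by
    refine ⟨G.weightTuple, G.weightTuple_pos, ?_⟩
    have : structuralPerturbation G.laplacian 0 = 0 :=
      (structuralPerturbationLinear G.laplacian).map_zero
    simpa [this] using hε₀
  obtain ⟨ε, ⟨hpos, hlt⟩, hnot⟩ : ∃ ε ∈ U,
      structuralPerturbation G.laplacian ε ∉ connectedLaplaciansZero n := by
    by_contra! hcon
    exact (hU.measure_pos volume hUne).ne' (measure_mono_null hcon
      (volume_structuralPerturbation_mem_connectedLaplaciansZero hM))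
  have heq : G.laplacian + structuralPerturbation G.laplacian (ε - G.weightTuple) =
      structuralPerturbation G.laplacian ε := by
    conv_lhs => lhs; rw [← G.structuralPerturbation_weightTuple]
    rw [← structuralPerturbation_add, add_sub_cancel]
  refine ⟨ε - G.weightTuple, ?_, hlt⟩
  rw [heq]
  refine ⟨hnot, ?_⟩
  rw [G.structuralPerturbation_eq_reweight ε hpos]
  exact ⟨G.reweight ε hpos, hG, rfl⟩

theorem theorem2 (n : ℕ) (hn : 2 ≤ n)
    (N : Seminorm ℝ (Matrix (Fin n) (Fin n) ℝ)) (hN : ∀ A, N A = 0 → A = 0) :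
    StructurallyGeneric N HasNonzeroFiedlerVector (connectedLaplacians n) ∧
    StructurallyDense N ((connectedLaplaciansZero n)ᶜ ∩ connectedLaplacians n)
      (connectedLaplacians n) ∧
    ∀ L ∈ connectedLaplacians n,
      volume {ε : WeightTuple n | structuralPerturbation L ε ∈ connectedLaplaciansZero n} = 0 := by
  have hdense := structurallyDense_compl_connectedLaplaciansZero N
  refine ⟨⟨fun M hM ε₀ hε₀ => ?_, fun M hM => ?_⟩, hdense, fun L hL =>
    volume_structuralPerturbation_mem_connectedLaplaciansZero hL⟩
  · obtain ⟨ε, ⟨hnot, hmem⟩, hlt⟩ := hdense M hM ε₀ hε₀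
    exact ⟨ε, ⟨hmem, hasNonzeroFiedlerVector_of_notMem hn hmem hnot⟩, hlt⟩
  · refine measure_mono_null (fun ε hε => ?_)
      (volume_structuralPerturbation_mem_connectedLaplaciansZero hM)
    by_contra hnot
    exact hε.2 (hasNonzeroFiedlerVector_of_notMem hn hε.1 hnot)
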